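/- Let $\ell_\infty$ be the real Banach space of all bounded sequences of real numbers with the norm $\|f\|=\sup_n|f(n)|$, and let $B_{\ell_\infty}=\{f\in\ell_\infty:\|f\|\le 1\}$ be its closed unit ball, with the metric $d(f,g)=\|f-g\|$. Let $F:B_{\ell_\infty}\to B_{\ell_\infty}$ be a bijection that is non-expansive, i.e. $\|F(f)-F(g)\|\le\|f-g\|$ for all $f,g\in B_{\ell_\infty}$. Assume that at least one of the following two conditions holds: (a) for every extreme point $f$ of $B_{\ell_\infty}$, $F(f)$ is an extreme point of $B_{\ell_\infty}$; (b) $\inf\{\|F(f)\| : f\in B_{\ell_\infty},\ \|f\|=1\}>\tfrac12$. Then $F$ is an isometry, i.e. $\|F(f)-F(g)\|=\|f-g\|$ for all $f,g\in B_{\ell_\infty}$. -/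

import Mathlib

open scoped ENNReal

/-- The real Banach space `ℓ∞` of bounded real sequences, with the supremum norm. -/
abbrev EllInfty : Type := lp (fun _ : ℕ => ℝ) ∞

/-- The closed unit ball of `ℓ∞`, as a set; as a type it carries the induced metric. -/
abbrev unitBallEllInfty : Set EllInfty := Metric.closedBall (0 : EllInfty) 1

/-!
The extreme points of the unit ball of `ℓ∞` are the sign vectors (all coordinates `±1`). The
proof first determines a non-expansive bijection `F` on the preimages of the sign vectors, and
then shows that this determines `F`.

*Preimages of sign vectors.* `F` fixes `0`, and preimages of opposite sign vectors are opposite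
(their midpoint is mapped to `0`). Let `x = t δ_m` with `0 < t ≤ 1`, let `F x` be nonzero at `k`,
and let `F g` be a sign vector with the sign of `F x` at `k`. Then `F x` has distance
`1 + |F x k|` from `-F g = F (-g)`, so `‖x + g‖ > 1`, which can only come from the coordinate `m`:
`g m > 1 - t` (`le_unitSign_mul_coord`). Letting `t → 0`, one finds a map `σ` and signs `ε m` with
`g m = ε m * F g (σ m)` for every such `g` (`exists_coord_preimage_eq`). Injectivity of `F⁻¹`
makes `σ` surjective. Condition (a) makes every sign vector one of the `g`, so `σ` is injective.
If `σ m = σ m'` with `m ≠ m'`, suitably signed unit vectors at `m` and `m'` have images of opposite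
sign at `σ m`; their distance is at most `1`, so the norms of the images cannot both exceed `1/2`,
and (b) makes `σ` injective too.

*Sign vectors determine the map.* With `U` the signed permutation of coordinates given by `σ` and
`ε`, the map `H = F ∘ U` is a non-expansive bijection fixing the sign vectors, and the claim
becomes `H = id` (`eq_self_of_fixes_sign`). Distances to sign vectors show that `H` keeps signs and
does not increase moduli. If moreover a fixed point `w` has the value `±1` at `n` with the sign of
`x n`, and `|w - x| ≤ 1 - ρ` elsewhere, then `|H x n| ≥ min ρ |x n|`, so that coordinates of `H x`
of modulus below `ρ` or equal to `1` agree with those of `x` (`coord_map_eq_of_abs_lt`). Since `H`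
is onto, a point `y = H x` is fixed as soon as `x` can be rounded to such a fixed `w` for each `n`.
This enlarges the set of known fixed points in steps: from sign vectors to points with coordinates
`±1` off a finite set; to points whose coordinates of modulus below `1` have moduli tending to
some `θ < 1` from below; by closedness, letting `θ → 0`, to points with coordinates in
`{-1, 0, 1}`; and then, by rounding moduli to `[0, θ] ∪ {1}` with `θ` replaced repeatedly by
`(1 + θ) / 2`, to the whole ball.
-/

namespace UnitBallEllInfty

/-! ### Coordinates on the unit ball -/

/-- The `k`-th coordinate of a point of the unit ball of `ℓ∞`. -/
def coord (x : unitBallEllInfty) (k : ℕ) : ℝ := (x : EllInfty) k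

theorem abs_coord_le_one (x : unitBallEllInfty) (k : ℕ) : |coord x k| ≤ 1 :=
  (lp.norm_apply_le_norm ENNReal.top_ne_zero (x : EllInfty) k).trans
    (mem_closedBall_zero_iff.mp x.2)

theorem coord_mem (x : unitBallEllInfty) (k : ℕ) : -1 ≤ coord x k ∧ coord x k ≤ 1 :=
  abs_le.mp (abs_coord_le_one x k)

theorem ext_coord {x y : unitBallEllInfty} (h : ∀ k, coord x k = coord y k) : x = y :=
  Subtype.ext (lp.ext (funext h))

theorem exists_coord (f : ℕ → ℝ) (hf : ∀ k, |f k| ≤ 1) :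
    ∃ x : unitBallEllInfty, ∀ k, coord x k = f k := by
  have hmem : Memℓp (E := fun _ : ℕ => ℝ) f ∞ :=
    memℓp_infty ⟨1, by rintro _ ⟨k, rfl⟩; exact hf k⟩
  refine ⟨⟨⟨f, hmem⟩, mem_closedBall_zero_iff.mpr ?_⟩, fun k => rfl⟩
  exact lp.norm_le_of_forall_le zero_le_one hf

theorem norm_le_iff {x : unitBallEllInfty} {r : ℝ} (hr : 0 ≤ r) :
    ‖(x : EllInfty)‖ ≤ r ↔ ∀ k, |coord x k| ≤ r :=
  ⟨fun h k => (lp.norm_apply_le_norm ENNReal.top_ne_zero (x : EllInfty) k).trans h,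
    fun h => lp.norm_le_of_forall_le hr h⟩

theorem dist_le_iff {x y : unitBallEllInfty} {r : ℝ} (hr : 0 ≤ r) :
    dist x y ≤ r ↔ ∀ k, |coord x k - coord y k| ≤ r := by
  rw [Subtype.dist_eq, dist_eq_norm]
  exact ⟨fun h k =>
      (lp.norm_apply_le_norm ENNReal.top_ne_zero ((x : EllInfty) - (y : EllInfty)) k).trans h,
    fun h => lp.norm_le_of_forall_le hr h⟩

theorem abs_coord_map_sub_le {H : unitBallEllInfty → unitBallEllInfty} (hL : LipschitzWith 1 H)
    {x y : unitBallEllInfty} {r : ℝ} (h : ∀ k, |coord x k - coord y k| ≤ r) (n : ℕ) :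
    |coord (H x) n - coord (H y) n| ≤ r := by
  have hr : 0 ≤ r := (abs_nonneg _).trans (h 0)
  refine (dist_le_iff hr).mp ?_ n
  simpa using (hL.dist_le_mul x y).trans (by simpa using (dist_le_iff hr).mpr h)

/-- The sign of a real number, with value `1` (rather than `0`) at `0`. -/
noncomputable def unitSign (a : ℝ) : ℝ := if 0 ≤ a then 1 else -1

theorem abs_unitSign (a : ℝ) : |unitSign a| = 1 := by
  unfold unitSign; split_ifs <;> simp

theorem unitSign_mul_self (a : ℝ) : unitSign a * a = |a| := by
  unfold unitSign
  split_ifs with h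
  · rw [abs_of_nonneg h, one_mul]
  · rw [abs_of_neg (not_le.mp h), neg_one_mul]

theorem abs_unitSign_mul_sub (a c : ℝ) : |unitSign a * c - a| = |c - (|a|)| := by
  unfold unitSign
  split_ifs with h
  · rw [abs_of_nonneg h, one_mul]
  · rw [abs_of_neg (not_le.mp h), ← abs_neg]; congr 1; ring

theorem abs_unitSign_sub (a : ℝ) : |unitSign a - a| = |1 - (|a|)| := by
  simpa using abs_unitSign_mul_sub a 1

/-- A point of the unit ball all of whose coordinates are `±1`. -/
def IsSign (e : unitBallEllInfty) : Prop := ∀ k, |coord e k| = 1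

/-! ### Non-expansive bijections fixing the sign vectors -/

section FixSign

variable {H : unitBallEllInfty → unitBallEllInfty}

theorem coord_map_le_max (hL : LipschitzWith 1 H) (hE : ∀ e, IsSign e → H e = e)
    (x : unitBallEllInfty) (n : ℕ) : coord (H x) n ≤ max 0 (coord x n) := by
  -- Away from `n` the sign vector `e` is within distance `1` of `x`.
  obtain ⟨e, he⟩ := exists_coord (fun k => if k = n then -1 else unitSign (coord x k)) (by
    intro k; split_ifs <;> simp [abs_unitSign])
  have hs : IsSign e := by intro k; rw [he]; split_ifs <;> simp [abs_unitSign]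
  have key := abs_coord_map_sub_le hL (x := x) (y := e) (r := 1 + max 0 (coord x n)) (by
    intro k
    rw [he]
    have := coord_mem x k
    split_ifs with hk
    · subst hk
      have := le_max_right 0 (coord x k)
      rw [abs_le]; constructor <;> linarith
    · rw [abs_sub_comm, abs_unitSign_sub]
      have h0 := abs_coord_le_one x k
      have := le_max_left 0 (coord x n)
      have := abs_nonneg (coord x k)
      rw [abs_le]; constructor <;> linarith) n
  rw [hE e hs, he, if_pos rfl] at key
  linarith [(abs_le.mp key).2]

theorem min_le_coord_map (hL : LipschitzWith 1 H) (hE : ∀ e, IsSign e → H e = e)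
    (x : unitBallEllInfty) (n : ℕ) : min 0 (coord x n) ≤ coord (H x) n := by
  obtain ⟨e, he⟩ := exists_coord (fun k => if k = n then 1 else unitSign (coord x k)) (by
    intro k; split_ifs <;> simp [abs_unitSign])
  have hs : IsSign e := by intro k; rw [he]; split_ifs <;> simp [abs_unitSign]
  have key := abs_coord_map_sub_le hL (x := x) (y := e) (r := 1 - min 0 (coord x n)) (by
    intro k
    rw [he]
    have := coord_mem x k
    split_ifs with hk
    · subst hk
      have := min_le_right 0 (coord x k)
      rw [abs_le]; constructor <;> linarith
    · rw [abs_sub_comm, abs_unitSign_sub]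
      have h0 := abs_coord_le_one x k
      have := min_le_left 0 (coord x n)
      have := abs_nonneg (coord x k)
      rw [abs_le]; constructor <;> linarith) n
  rw [hE e hs, he, if_pos rfl] at key
  linarith [(abs_le.mp key).1]

theorem abs_coord_map_le (hL : LipschitzWith 1 H) (hE : ∀ e, IsSign e → H e = e)
    (x : unitBallEllInfty) (n : ℕ) : |coord (H x) n| ≤ |coord x n| :=
  abs_le.mpr ⟨(le_min (by simp) (neg_abs_le _)).trans (min_le_coord_map hL hE x n),
    (coord_map_le_max hL hE x n).trans (max_le (abs_nonneg _) (le_abs_self _))⟩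

/-- `H` shrinks moduli and keeps signs, so a coordinate moves only if its modulus drops. -/
theorem coord_map_eq_of_abs_le (hL : LipschitzWith 1 H) (hE : ∀ e, IsSign e → H e = e)
    {x : unitBallEllInfty} {n : ℕ} (h : |coord x n| ≤ |coord (H x) n|) :
    coord (H x) n = coord x n := by
  have h1 := coord_map_le_max hL hE x n
  have h2 := min_le_coord_map hL hE x n
  rcases le_total 0 (coord x n) with h0 | h0
  · rw [max_eq_right h0] at h1
    rw [min_eq_left h0] at h2
    rw [abs_of_nonneg h0, abs_of_nonneg h2] at h
    exact le_antisymm h1 h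
  · rw [max_eq_left h0] at h1
    rw [min_eq_right h0] at h2
    rw [abs_of_nonpos h0, abs_of_nonpos h1] at h
    linarith

theorem coord_map_eq_of_abs_eq_one (hL : LipschitzWith 1 H) (hE : ∀ e, IsSign e → H e = e)
    {x : unitBallEllInfty} {n : ℕ} (h : |coord (H x) n| = 1) : coord (H x) n = coord x n :=
  coord_map_eq_of_abs_le hL hE (h ▸ abs_coord_le_one x n)

/-- The test by which fixed points produce fixed points: if a fixed point `w` has the value `±1`
at `n`, with the sign of `x n`, and is within `1 - ρ` of `x` elsewhere, then
`|H x n| ≥ min ρ |x n|`; so a coordinate of `H x` of modulus below `ρ` was not moved. -/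
theorem coord_map_eq_of_abs_lt (hL : LipschitzWith 1 H) (hE : ∀ e, IsSign e → H e = e)
    {x w : unitBallEllInfty} {n : ℕ} {ρ : ℝ} (hw : H w = w)
    (hwn : coord w n = unitSign (coord x n))
    (hwx : ∀ k, k ≠ n → |coord w k - coord x k| ≤ 1 - ρ) (hlt : |coord (H x) n| < ρ) :
    coord (H x) n = coord x n := by
  refine coord_map_eq_of_abs_le hL hE ?_
  have key := abs_coord_map_sub_le hL (x := x) (y := w)
    (r := max (1 - ρ) (1 - |coord x n|)) (by
      intro k
      rw [abs_sub_comm]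
      by_cases hk : k = n
      · subst hk
        rw [hwn, abs_unitSign_sub, abs_of_nonneg (sub_nonneg.mpr (abs_coord_le_one x k))]
        exact le_max_right _ _
      · exact (hwx k hk).trans (le_max_left _ _)) n
  rw [hw, hwn] at key
  have h1 : 1 - |coord (H x) n| ≤ max (1 - ρ) (1 - |coord x n|) := by
    refine le_trans ?_ key
    rw [abs_sub_comm, ← abs_unitSign (coord x n)]
    exact abs_sub_abs_le_abs_sub _ _
  rcases le_max_iff.mp h1 with h | h <;> linarith

theorem fixed_of_approx (hL : LipschitzWith 1 H) {y : unitBallEllInfty}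
    (h : ∀ η : ℝ, 0 < η → ∃ z, H z = z ∧ ∀ k, |coord z k - coord y k| ≤ η) : H y = y := by
  refine ext_coord fun n => ?_
  refine eq_of_forall_dist_le fun ε hε => ?_
  rw [Real.dist_eq]
  obtain ⟨z, hz, hzy⟩ := h (ε / 2) (by positivity)
  have h1 := abs_coord_map_sub_le hL hzy n
  rw [hz] at h1
  have h2 := hzy n
  rw [abs_le] at *
  constructor <;> linarith

theorem fixed_of_finite (hL : LipschitzWith 1 H) (hb : Function.Bijective H)
    (hE : ∀ e, IsSign e → H e = e) (A : Finset ℕ) :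
    ∀ y : unitBallEllInfty, (∀ k, k ∉ A → |coord y k| = 1) → H y = y := by
  induction A using Finset.strongInduction with
  | H A ih =>
    intro y hy
    obtain ⟨x, rfl⟩ := hb.2 y
    have hone : ∀ k, k ∉ A → |coord x k| = 1 := fun k hk => by
      rw [← coord_map_eq_of_abs_eq_one hL hE (hy k hk), hy k hk]
    suffices hx : H x = x by rw [hx, hx]
    refine ext_coord fun n => ?_
    rcases (abs_coord_le_one (H x) n).eq_or_lt with h1 | h1
    · exact coord_map_eq_of_abs_eq_one hL hE h1
    have hnA : n ∈ A := by
      by_contra hn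
      exact h1.ne (hy n hn)
    -- Raising the coordinate `n` of `x` to modulus `1` leaves fewer free coordinates.
    obtain ⟨w, hw⟩ := exists_coord (fun k => if k = n then unitSign (coord x k) else coord x k) (by
      intro k; split_ifs <;> simp [abs_unitSign, abs_coord_le_one])
    refine coord_map_eq_of_abs_lt hL hE (w := w) (ρ := 1) ?_ (by simp [hw]) ?_ h1
    · refine ih (A.erase n) (Finset.erase_ssubset hnA) w fun k hk => ?_
      rw [hw]
      split_ifs with hkn
      · exact abs_unitSign _
      · exact hone k fun hkA => hk (Finset.mem_erase.mpr ⟨hkn, hkA⟩)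
    · intro k hk
      simp [hw, hk]

/-- Points whose coordinates are `±1` or of modulus below `θ` and accumulating only at modulus `θ`
are fixed. -/
theorem fixed_of_tendsto (hL : LipschitzWith 1 H) (hb : Function.Bijective H)
    (hE : ∀ e, IsSign e → H e = e) {θ : ℝ} (hθ : θ < 1) {y : unitBallEllInfty}
    (hy : ∀ k, |coord y k| < θ ∨ |coord y k| = 1)
    (hfin : ∀ ρ < θ, {k | |coord y k| ≤ ρ}.Finite) : H y = y := by
  obtain ⟨x, rfl⟩ := hb.2 y
  suffices hx : H x = x by rw [hx, hx]
  refine ext_coord fun n => ?_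
  rcases hy n with hn | hn
  swap
  · exact coord_map_eq_of_abs_eq_one hL hE hn
  obtain ⟨ρ, hnρ, hρ⟩ := exists_between hn
  -- Only finitely many coordinates of `x` are below `ρ`; raising all others to modulus `1` costs
  -- at most `1 - ρ`.
  obtain ⟨w, hw⟩ := exists_coord
    (fun k => if k ≠ n ∧ |coord x k| ≤ ρ then coord x k else unitSign (coord x k)) (by
      intro k; split_ifs <;> simp [abs_unitSign, abs_coord_le_one])
  refine coord_map_eq_of_abs_lt hL hE (w := w) (ρ := ρ) ?_ (by simp [hw]) ?_ hnρ
  · refine fixed_of_finite hL hb hE (hfin ρ hρ).toFinset w fun k hk => ?_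
    rw [hw, if_neg, abs_unitSign]
    rintro ⟨-, hk'⟩
    exact hk (by simpa using (abs_coord_map_le hL hE x k).trans hk')
  · intro k hk
    rw [hw]
    split_ifs with h
    · simpa using (hρ.trans hθ).le
    · rw [abs_unitSign_sub, abs_of_nonneg (sub_nonneg.mpr (abs_coord_le_one x k))]
      have : ρ < |coord x k| := not_le.mp fun h' => h ⟨hk, h'⟩
      linarith

theorem fixed_of_zero_or_sign (hL : LipschitzWith 1 H) (hb : Function.Bijective H)
    (hE : ∀ e, IsSign e → H e = e) {y : unitBallEllInfty}
    (hy : ∀ k, coord y k = 0 ∨ |coord y k| = 1) : H y = y := by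
  refine fixed_of_approx hL fun η hη => ?_
  obtain ⟨θ, hθ0, hθ⟩ := exists_between (lt_min hη one_pos)
  obtain ⟨hθη, hθ1⟩ := lt_min_iff.mp hθ
  -- Replace the zeros of `y` by small coordinates strictly increasing to `θ`.
  have hval : ∀ k : ℕ, 0 ≤ θ - θ / (k + 1) ∧ θ - θ / (k + 1) < θ := fun k => by
    have h1 : θ / (k + 1) ≤ θ := div_le_self hθ0.le (by linarith [Nat.cast_nonneg (α := ℝ) k])
    have h2 : 0 < θ / (k + 1) := by positivity
    constructor <;> linarith
  obtain ⟨z, hz⟩ := exists_coord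
    (fun k => if coord y k = 0 then θ - θ / (k + 1) else coord y k) (by
      intro k
      split_ifs
      · rw [abs_of_nonneg (hval k).1]; linarith [(hval k).2]
      · exact abs_coord_le_one y k)
  refine ⟨z, fixed_of_tendsto hL hb hE hθ1 (fun k => ?_) fun ρ hρ => ?_, fun k => ?_⟩
  · rw [hz]
    split_ifs with h
    · left; rw [abs_of_nonneg (hval k).1]; exact (hval k).2
    · exact Or.inr ((hy k).resolve_left h)
  · obtain ⟨N, hN⟩ := exists_nat_gt (θ / (θ - ρ))
    refine (Set.finite_lt_nat N).subset fun k hk => ?_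
    simp only [Set.mem_ofPred_eq, hz] at hk ⊢
    split_ifs at hk with h
    · rw [abs_of_nonneg (hval k).1] at hk
      have h1 : θ - ρ ≤ θ / (k + 1) := by linarith
      have hpos : (0 : ℝ) < θ - ρ := by linarith
      have h2 : (k : ℝ) + 1 ≤ θ / (θ - ρ) := by
        rw [le_div_iff₀ (by positivity)] at h1
        rw [le_div_iff₀ hpos]; linarith
      have h3 : (k : ℝ) < N := by linarith
      exact_mod_cast h3
    · rw [(hy k).resolve_left h] at hk
      linarith
  · rw [hz]
    split_ifs with h
    · rw [h, sub_zero, abs_of_nonneg (hval k).1]; linarith [(hval k).2]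
    · simpa using hη.le

/-- `H` fixes every point whose coordinates are `±1` or of modulus at most `θ`. -/
def FixesUpTo (H : unitBallEllInfty → unitBallEllInfty) (θ : ℝ) : Prop :=
  ∀ y, (∀ k, |coord y k| ≤ θ ∨ |coord y k| = 1) → H y = y

/-- Scaling the coordinates of modulus other than `1` by `t` moves a point by at most `1 - t`. -/
theorem exists_scale (y : unitBallEllInfty) {t : ℝ} (ht0 : 0 ≤ t) (ht1 : t ≤ 1) :
    ∃ z : unitBallEllInfty, (∀ k, |coord z k - coord y k| ≤ 1 - t) ∧
      ∀ k, |coord z k| = 1 ∨ |coord y k| ≠ 1 ∧ |coord z k| = t * |coord y k| := by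
  obtain ⟨z, hz⟩ := exists_coord
    (fun k => if |coord y k| = 1 then coord y k else t * coord y k) (by
      intro k
      split_ifs with h
      · exact h.le
      · rw [abs_mul, abs_of_nonneg ht0]
        exact mul_le_one₀ ht1 (abs_nonneg _) (abs_coord_le_one y k))
  refine ⟨z, fun k => ?_, fun k => ?_⟩
  · rw [hz]
    split_ifs with h
    · simpa using ht1
    · have : t * coord y k - coord y k = -((1 - t) * coord y k) := by ring
      rw [this, abs_neg, abs_mul, abs_of_nonneg (sub_nonneg.mpr ht1)]
      exact mul_le_of_le_one_right (sub_nonneg.mpr ht1) (abs_coord_le_one y k)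
  · rw [hz]
    split_ifs with h
    · exact Or.inl h
    · exact Or.inr ⟨h, by rw [abs_mul, abs_of_nonneg ht0]⟩

/-- Rounding moduli between `θ` and `1` to the nearer of these two costs at most `(1 - θ) / 2`,
so the threshold can be moved half way towards `1`. -/
theorem FixesUpTo.half (hL : LipschitzWith 1 H) (hb : Function.Bijective H)
    (hE : ∀ e, IsSign e → H e = e) {θ : ℝ} (h0 : 0 ≤ θ) (h1 : θ < 1) (h : FixesUpTo H θ) :
    FixesUpTo H ((1 + θ) / 2) := by
  set m := (1 + θ) / 2 with hm
  have hstrict : ∀ y, (∀ k, |coord y k| < m ∨ |coord y k| = 1) → H y = y := by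
    intro y hy
    obtain ⟨x, rfl⟩ := hb.2 y
    suffices hx : H x = x by rw [hx, hx]
    refine ext_coord fun n => ?_
    rcases hy n with hn | hn
    swap
    · exact coord_map_eq_of_abs_eq_one hL hE hn
    obtain ⟨w, hw⟩ := exists_coord (fun k =>
      if k = n ∨ m ≤ |coord x k| then unitSign (coord x k)
      else if θ < |coord x k| then unitSign (coord x k) * θ else coord x k) (by
        intro k
        split_ifs
        · rw [abs_unitSign]
        · rw [abs_mul, abs_unitSign, one_mul, abs_of_nonneg h0]; exact h1.le
        · exact abs_coord_le_one x k)
    refine coord_map_eq_of_abs_lt hL hE (w := w) (ρ := m) ?_ (by simp [hw]) ?_ hn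
    · refine h w fun k => ?_
      rw [hw]
      split_ifs with hk hk'
      · exact Or.inr (abs_unitSign _)
      · left; rw [abs_mul, abs_unitSign, one_mul, abs_of_nonneg h0]
      · exact Or.inl (not_lt.mp hk')
    · intro k hkn
      rw [hw]
      split_ifs with hk hk'
      · rw [abs_unitSign_sub, abs_of_nonneg (sub_nonneg.mpr (abs_coord_le_one x k))]
        linarith [hk.resolve_left hkn]
      · rw [abs_unitSign_mul_sub, abs_of_neg (sub_neg.mpr hk')]
        have : |coord x k| < m := not_le.mp fun h' => hk (Or.inr h')
        linarith
      · rw [sub_self, abs_zero]; linarith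
  intro y hy
  refine fixed_of_approx hL fun η hη => ?_
  obtain ⟨s, hs0, hs⟩ := exists_between (lt_min hη one_pos)
  obtain ⟨hsη, hs1⟩ := lt_min_iff.mp hs
  obtain ⟨z, hzy, hz⟩ := exists_scale y (t := 1 - s) (by linarith) (by linarith)
  refine ⟨z, hstrict z fun k => ?_, fun k => (hzy k).trans (by linarith)⟩
  rcases hz k with h' | h'
  · exact Or.inr h'
  · left
    have hk := (hy k).resolve_right h'.1
    rw [h'.2]
    have hle : (1 - s) * |coord y k| ≤ (1 - s) * m := mul_le_mul_of_nonneg_left hk (by linarith)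
    have hpos : 0 < s * m := mul_pos hs0 (by linarith)
    linarith

/-- A non-expansive bijection of the unit ball of `ℓ∞` that fixes all sign vectors is the
identity. -/
theorem eq_self_of_fixes_sign (hL : LipschitzWith 1 H) (hb : Function.Bijective H)
    (hE : ∀ e, IsSign e → H e = e) (y : unitBallEllInfty) : H y = y := by
  have hstep : ∀ j : ℕ, FixesUpTo H (1 - (1 / 2) ^ j) := by
    intro j
    induction j with
    | zero =>
      refine fun y hy => fixed_of_zero_or_sign hL hb hE fun k => (hy k).imp_left fun h => ?_
      simpa using h
    | succ j ih =>
      have hp : (0 : ℝ) < (1 / 2) ^ j := by positivity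
      have hp1 : ((1 : ℝ) / 2) ^ j ≤ 1 := pow_le_one₀ (by norm_num) (by norm_num)
      have := ih.half hL hb hE (by linarith) (by linarith)
      rwa [show (1 + (1 - (1 / 2 : ℝ) ^ j)) / 2 = 1 - (1 / 2) ^ (j + 1) by ring] at this
  refine fixed_of_approx hL fun η hη => ?_
  obtain ⟨j, hj⟩ := exists_pow_lt_of_lt_one hη (by norm_num : (1 / 2 : ℝ) < 1)
  have hp1 : ((1 : ℝ) / 2) ^ j ≤ 1 := pow_le_one₀ (by norm_num) (by norm_num)
  obtain ⟨z, hzy, hz⟩ := exists_scale y (t := 1 - (1 / 2) ^ j) (by linarith)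
    (by linarith [show (0 : ℝ) < (1 / 2) ^ j by positivity])
  refine ⟨z, hstep j z fun k => ?_, fun k => (hzy k).trans (by linarith)⟩
  rcases hz k with h | h
  · exact Or.inr h
  · left
    rw [h.2]
    exact mul_le_of_le_one_right (by linarith) (abs_coord_le_one y k)

end FixSign

/-! ### Extreme points -/

theorem mem_extremePoints_iff_isSign (f : unitBallEllInfty) :
    (f : EllInfty) ∈ Set.extremePoints ℝ unitBallEllInfty ↔ IsSign f := by
  rw [mem_extremePoints_iff_left]
  constructor
  · rintro ⟨-, hf⟩ n
    by_contra hn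
    have hlt : |coord f n| < 1 := lt_of_le_of_ne (abs_coord_le_one f n) hn
    -- A coordinate of modulus below `1` can be moved both ways by `1 - |f n|`.
    have hex : ∀ s : ℝ, |s| = 1 → ∃ x : unitBallEllInfty, ∀ k,
        coord x k = if k = n then coord f k + s * (1 - |coord f n|) else coord f k := by
      intro s hs
      refine exists_coord _ fun k => ?_
      split_ifs with hk
      · subst hk
        refine (abs_add_le _ _).trans ?_
        rw [abs_mul, hs, one_mul, abs_of_pos (sub_pos.mpr hlt)]
        linarith
      · exact abs_coord_le_one f k
    obtain ⟨x, hx⟩ := hex 1 (by simp)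
    obtain ⟨y, hy⟩ := hex (-1) (by simp)
    have hseg : (f : EllInfty) ∈ openSegment ℝ (x : EllInfty) (y : EllInfty) := by
      refine ⟨1 / 2, 1 / 2, by norm_num, by norm_num, by norm_num, ?_⟩
      refine lp.ext (funext fun k => ?_)
      change 1 / 2 * coord x k + 1 / 2 * coord y k = coord f k
      rw [hx, hy]
      split_ifs <;> ring
    have hxf : x = f := Subtype.ext (hf x x.2 y y.2 hseg)
    have := hx n
    rw [hxf, if_pos rfl] at this
    linarith
  · refine fun hf => ⟨f.2, ?_⟩
    rintro x hx y hy ⟨a, b, ha, hb, hab, hfxy⟩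
    refine congrArg Subtype.val (ext_coord (x := ⟨x, hx⟩) (y := f) fun k => ?_)
    have h1 := coord_mem ⟨x, hx⟩ k
    have h2 := coord_mem ⟨y, hy⟩ k
    have h3 : a * coord ⟨x, hx⟩ k + b * coord ⟨y, hy⟩ k = coord f k := by
      rw [coord, coord, coord, ← hfxy]; rfl
    have hb' : b = 1 - a := by linarith
    subst hb'
    rcases eq_or_eq_neg_of_abs_eq (hf k) with h | h <;> rw [h] at h3 ⊢
    · have : a * coord ⟨x, hx⟩ k ≥ a := by nlinarith
      have : 1 ≤ coord ⟨x, hx⟩ k := le_of_mul_le_mul_left (by linarith) ha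
      linarith
    · have : a * coord ⟨x, hx⟩ k ≤ -a := by nlinarith
      have : coord ⟨x, hx⟩ k ≤ -1 := le_of_mul_le_mul_left (by linarith) ha
      linarith

/-! ### Preimages of the sign vectors -/

section Preimage

variable {F : unitBallEllInfty → unitBallEllInfty}

/-- If `F 0` were nonzero at `k`, it would be at distance more than `1` from some sign vector. -/
theorem coord_map_zero (hL : LipschitzWith 1 F) (hs : Function.Surjective F)
    {x : unitBallEllInfty} (hx : ∀ k, coord x k = 0) (k : ℕ) : coord (F x) k = 0 := by
  obtain ⟨p, hp⟩ := exists_coord (fun k => -unitSign (coord (F x) k)) (by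
    intro k; simp [abs_unitSign])
  obtain ⟨q, rfl⟩ := hs p
  have key := abs_coord_map_sub_le hL (x := q) (y := x) (r := 1) (by
    intro j; simpa [hx] using abs_coord_le_one q j) k
  rw [hp, ← neg_add', abs_neg] at key
  have h1 := unitSign_mul_self (coord (F x) k)
  have h2 : |unitSign (coord (F x) k) + coord (F x) k| = 1 + |coord (F x) k| := by
    unfold unitSign
    split_ifs with h
    · rw [abs_of_nonneg h, abs_of_nonneg (by linarith)]
    · rw [abs_of_neg (not_le.mp h), abs_of_neg (by linarith)]; ring
  rw [h2] at key
  exact abs_nonpos_iff.mp (by linarith)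

/-- Preimages of opposite sign vectors are opposite: their midpoint is mapped to `0`. -/
theorem coord_eq_neg_of_map_eq_neg (hL : LipschitzWith 1 F) (hb : Function.Bijective F)
    {g g' : unitBallEllInfty} (hg : IsSign (F g)) (hgg' : ∀ k, coord (F g') k = -coord (F g) k)
    (k : ℕ) : coord g' k = -coord g k := by
  obtain ⟨z, hz⟩ := exists_coord (fun _ => 0) (by simp)
  obtain ⟨p, hp⟩ := exists_coord (fun k => (coord g k + coord g' k) / 2) (by
    intro k
    have := coord_mem g k
    have := coord_mem g' k
    rw [abs_le]; constructor <;> linarith)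
  have hpz : p = z := by
    refine hb.1 (ext_coord fun n => ?_)
    rw [coord_map_zero hL hb.2 hz]
    have h1 := abs_coord_map_sub_le hL (x := p) (y := g) (r := 1) (by
      intro j
      have := coord_mem g j
      have := coord_mem g' j
      rw [hp, abs_le]; constructor <;> linarith) n
    have h2 := abs_coord_map_sub_le hL (x := p) (y := g') (r := 1) (by
      intro j
      have := coord_mem g j
      have := coord_mem g' j
      rw [hp, abs_le]; constructor <;> linarith) n
    rw [hgg'] at h2
    rw [abs_le] at h1 h2
    rcases eq_or_eq_neg_of_abs_eq (hg n) with h | h <;> rw [h] at h1 h2 <;> linarith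
  have := hp k
  rw [hpz, hz] at this
  linarith

theorem exists_neg_preimage (hL : LipschitzWith 1 F) (hb : Function.Bijective F)
    {g : unitBallEllInfty} (hg : IsSign (F g)) :
    ∃ g', (∀ k, coord (F g') k = -coord (F g) k) ∧ ∀ k, coord g' k = -coord g k := by
  obtain ⟨e, he⟩ := exists_coord (fun k => -coord (F g) k) (by
    intro k; simpa using abs_coord_le_one _ k)
  obtain ⟨g', rfl⟩ := hb.2 e
  exact ⟨g', he, coord_eq_neg_of_map_eq_neg hL hb hg he⟩

/-- Compare the image of a point `x` supported at `m` with a sign vector agreeing in sign with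
`F x` at `k`: the preimage `g` of the sign vector is then large at `m`. The reason is that
`x + g` has norm at least `1 + |F x k| > 1`, and this can only happen at the coordinate `m`. -/
theorem le_unitSign_mul_coord (hL : LipschitzWith 1 F) (hb : Function.Bijective F)
    {x g : unitBallEllInfty} {m k : ℕ} (hx : ∀ j, j ≠ m → coord x j = 0) (hg : IsSign (F g))
    (hpos : 0 < coord (F g) k * coord (F x) k) :
    1 - |coord x m| + |coord (F x) k| ≤ unitSign (coord x m) * coord g m := by
  obtain ⟨g', hFg', hg'⟩ := exists_neg_preimage hL hb hg
  have key := abs_coord_map_sub_le hL (x := x) (y := g') (r := max 1 |coord x m + coord g m|) (by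
    intro j
    rw [hg', sub_neg_eq_add]
    by_cases hj : j = m
    · subst hj; exact le_max_right _ _
    · rw [hx j hj, zero_add]
      exact (abs_coord_le_one g j).trans (le_max_left _ _)) k
  rw [hFg', sub_neg_eq_add] at key
  have h1 : |coord (F x) k + coord (F g) k| = |coord (F x) k| + 1 := by
    rw [← hg k]
    rcases eq_or_eq_neg_of_abs_eq (hg k) with h | h <;> rw [h] at hpos ⊢
    · have : 0 < coord (F x) k := by linarith
      rw [abs_of_pos this, abs_one, abs_of_pos (by linarith)]
    · have : coord (F x) k < 0 := by linarith
      rw [abs_of_neg this, abs_neg, abs_one, abs_of_neg (by linarith)]; ring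
  rw [h1] at key
  have hy : 0 < |coord (F x) k| := abs_pos.mpr fun h => by simp [h] at hpos
  have h2 : |coord (F x) k| + 1 ≤ |coord x m + coord g m| := by
    rcases le_max_iff.mp key with h | h
    · linarith
    · exact h
  have := coord_mem g m
  unfold unitSign
  split_ifs with h
  · rw [abs_of_nonneg h]
    rcases abs_cases (coord x m + coord g m) with h' | h' <;> linarith
  · rw [abs_of_neg (not_le.mp h)]
    rcases abs_cases (coord x m + coord g m) with h' | h' <;> linarith

theorem exists_preimage_sign (hs : Function.Surjective F) (f : ℕ → ℝ) (hf : ∀ k, |f k| = 1) :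
    ∃ g, IsSign (F g) ∧ ∀ k, coord (F g) k = f k := by
  obtain ⟨e, he⟩ := exists_coord f fun k => (hf k).le
  obtain ⟨g, rfl⟩ := hs e
  exact ⟨g, fun k => by rw [he, hf], he⟩

theorem exists_lt_coord_preimage (hL : LipschitzWith 1 F) (hb : Function.Bijective F) (m : ℕ)
    {t : ℝ} (ht0 : 0 < t) (ht1 : t ≤ 1) :
    ∃ (k : ℕ) (ε : ℝ), |ε| = 1 ∧
      ∀ g, IsSign (F g) → coord (F g) k = ε → 1 - t < coord g m := by
  obtain ⟨x, hx⟩ := exists_coord (fun k => if k = m then t else 0) (by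
    intro k; split_ifs
    · rwa [abs_of_pos ht0]
    · simp)
  obtain ⟨z, hz⟩ := exists_coord (fun _ => 0) (by simp)
  have hk : ∃ k, coord (F x) k ≠ 0 := by
    by_contra! hcon
    have hxz : x = z := hb.1 (ext_coord fun k => by rw [hcon, coord_map_zero hL hb.2 hz])
    have := hx m
    rw [hxz, hz, if_pos rfl] at this
    exact ht0.ne this
  obtain ⟨k, hk⟩ := hk
  refine ⟨k, unitSign (coord (F x) k), abs_unitSign _, fun g hg hgk => ?_⟩
  have h := le_unitSign_mul_coord hL hb (x := x) (m := m) (k := k)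
    (fun j hj => by rw [hx, if_neg hj]) hg (by
      rw [hgk, unitSign_mul_self]; exact abs_pos.mpr hk)
  rw [hx, if_pos rfl, abs_of_pos ht0, unitSign, if_pos ht0.le, one_mul] at h
  linarith [abs_pos.mpr hk]

/-- Each coordinate of the preimage of a sign vector is, up to a fixed sign, a fixed coordinate
of that sign vector. -/
theorem exists_coord_preimage_eq (hL : LipschitzWith 1 F) (hb : Function.Bijective F) (m : ℕ) :
    ∃ (k : ℕ) (ε : ℝ), |ε| = 1 ∧ ∀ g, IsSign (F g) → coord g m = ε * coord (F g) k := by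
  obtain ⟨k, ε, hε, h⟩ := exists_lt_coord_preimage hL hb m one_pos le_rfl
  -- The coordinate and the sign found for `t = 1` serve every smaller `t`: otherwise some
  -- sign vector would satisfy one of the conditions while its negative satisfies the other.
  have hall : ∀ t : ℝ, 0 < t → t ≤ 1 →
      ∀ g, IsSign (F g) → coord (F g) k = ε → 1 - t < coord g m := by
    intro t ht0 ht1
    obtain ⟨k', ε', hε', h'⟩ := exists_lt_coord_preimage hL hb m ht0 ht1
    suffices hkk : k' = k ∧ ε' = ε by rw [← hkk.1, ← hkk.2]; exact h'
    by_contra hne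
    obtain ⟨g, hg, hFg⟩ := exists_preimage_sign hb.2
      (fun j => if j = k then ε else if j = k' then -ε' else 1) (by
        intro j; split_ifs <;> simp [hε, hε'])
    obtain ⟨g', hFg', hg'⟩ := exists_neg_preimage hL hb hg
    have h1 := h g hg (by rw [hFg, if_pos rfl])
    have h2 := h' g' (fun j => by rw [hFg', abs_neg, hg]) (by
      rw [hFg', hFg]
      by_cases hk : k' = k
      · rw [if_pos hk]
        have hne' : ε' ≠ ε := fun h => hne ⟨hk, h⟩
        rcases eq_or_eq_neg_of_abs_eq hε with h3 | h3 <;>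
          rcases eq_or_eq_neg_of_abs_eq hε' with h4 | h4 <;>
          simp_all
      · rw [if_neg hk, if_pos rfl, neg_neg])
    rw [hg'] at h2
    linarith
  have hone : ∀ g, IsSign (F g) → coord (F g) k = ε → coord g m = 1 := by
    intro g hg hgk
    refine le_antisymm (coord_mem g m).2 (le_of_forall_pos_lt_add fun t ht => ?_)
    have := hall (min t 1) (lt_min ht one_pos) (min_le_right _ _) g hg hgk
    linarith [min_le_left t 1]
  have hεε : ε * ε = 1 := by rcases eq_or_eq_neg_of_abs_eq hε with h | h <;> rw [h] <;> norm_num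
  refine ⟨k, ε, hε, fun g hg => ?_⟩
  rcases abs_eq_abs.mp ((hg k).trans hε.symm) with hgk | hgk
  · rw [hgk, hεε, hone g hg hgk]
  · obtain ⟨g', hFg', hg'⟩ := exists_neg_preimage hL hb hg
    have := hone g' (fun j => by rw [hFg', abs_neg, hg]) (by rw [hFg', hgk, neg_neg])
    rw [hg'] at this
    rw [hgk, mul_neg, hεε]
    linarith

/-- A point supported at `m` is mapped to a point supported at `σ m`, with the matching sign. -/
theorem eq_and_pos_of_coord_map_ne_zero (hL : LipschitzWith 1 F) (hb : Function.Bijective F)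
    {σ : ℕ → ℕ} {ε : ℕ → ℝ} (hε : ∀ m, |ε m| = 1)
    (hσ : ∀ m g, IsSign (F g) → coord g m = ε m * coord (F g) (σ m))
    {x : unitBallEllInfty} {m k : ℕ} (hx : ∀ j, j ≠ m → coord x j = 0)
    (hk : coord (F x) k ≠ 0) :
    k = σ m ∧ 0 < unitSign (coord x m) * ε m * coord (F x) k := by
  have hpos : ∀ g, IsSign (F g) → coord (F g) k = unitSign (coord (F x) k) →
      0 < unitSign (coord x m) * (ε m * coord (F g) (σ m)) := by
    intro g hg hgk
    have h := le_unitSign_mul_coord hL hb (k := k) hx hg (by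
      rw [hgk, unitSign_mul_self]; exact abs_pos.mpr hk)
    rw [hσ m g hg] at h
    linarith [abs_pos.mpr hk, abs_coord_le_one x m]
  set c := unitSign (coord x m) with hc
  have hcε : c * ε m = 1 ∨ c * ε m = -1 :=
    eq_or_eq_neg_of_abs_eq (by rw [abs_mul, hc, abs_unitSign, hε, one_mul])
  have hkσ : k = σ m := by
    by_contra hne
    obtain ⟨g, hg, hFg⟩ := exists_preimage_sign hb.2
      (fun j => if j = k then unitSign (coord (F x) k) else -(c * ε m)) (by
        intro j; split_ifs
        · exact abs_unitSign _
        · rw [abs_neg, abs_mul, hc, abs_unitSign, hε, one_mul])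
    have h := hpos g hg (by rw [hFg, if_pos rfl])
    rw [hFg, if_neg (Ne.symm hne), ← mul_assoc] at h
    rcases hcε with h' | h' <;> rw [h'] at h <;> norm_num at h
  refine ⟨hkσ, ?_⟩
  obtain ⟨g, hg, hFg⟩ := exists_preimage_sign hb.2 (fun _ => unitSign (coord (F x) k))
    fun _ => abs_unitSign _
  have h := hpos g hg (hFg k)
  rw [hFg, ← mul_assoc] at h
  have h2 := mul_pos h (abs_pos.mpr hk)
  have h3 : unitSign (coord (F x) k) * |coord (F x) k| = coord (F x) k := by
    rw [← unitSign_mul_self, ← mul_assoc, ← abs_mul_abs_self, abs_unitSign, one_mul, one_mul]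
  rwa [mul_assoc, h3] at h2

theorem surjective_of_coord_preimage_eq (hs : Function.Surjective F)
    {σ : ℕ → ℕ} {ε : ℕ → ℝ}
    (hσ : ∀ m g, IsSign (F g) → coord g m = ε m * coord (F g) (σ m)) :
    Function.Surjective σ := by
  intro k
  by_contra! hk
  obtain ⟨g, hg, hFg⟩ := exists_preimage_sign hs (fun _ => 1) (by simp)
  obtain ⟨g', hg', hFg'⟩ := exists_preimage_sign hs (fun j => if j = k then -1 else 1) (by
    intro j; split_ifs <;> simp)
  have hgg' : g = g' := ext_coord fun m => by
    rw [hσ m g hg, hσ m g' hg', hFg, hFg', if_neg (hk m)]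
  have := hFg' k
  rw [← hgg', hFg, if_pos rfl] at this
  norm_num at this

theorem injective_of_isSign_map {σ : ℕ → ℕ} {ε : ℕ → ℝ} (hε : ∀ m, |ε m| = 1)
    (hσ : ∀ m g, IsSign (F g) → coord g m = ε m * coord (F g) (σ m))
    (ha : ∀ f, IsSign f → IsSign (F f)) : Function.Injective σ := by
  intro m m' hmm'
  by_contra hne
  obtain ⟨f, hf⟩ := exists_coord (fun j => if j = m then ε j else -ε j) (by
    intro j; split_ifs <;> simp [hε])
  have hFf := ha f fun j => by rw [hf]; split_ifs <;> simp [hε]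
  have h1 := hσ m f hFf
  have h2 := hσ m' f hFf
  rw [hf, if_pos rfl] at h1
  rw [hf, if_neg (Ne.symm hne), ← hmm'] at h2
  rcases eq_or_eq_neg_of_abs_eq (hε m) with h3 | h3 <;>
    rcases eq_or_eq_neg_of_abs_eq (hε m') with h4 | h4 <;>
    rw [h3] at h1 <;> rw [h4] at h2 <;> linarith

/-- If `σ m = σ m'` with `m ≠ m'`, then the images of suitably signed unit vectors at `m` and `m'`
have opposite signs at `σ m` and hence distance above `1`, while the vectors have distance `1`. -/
theorem injective_of_half_lt_norm (hL : LipschitzWith 1 F) (hb : Function.Bijective F)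
    {σ : ℕ → ℕ} {ε : ℕ → ℝ} (hε : ∀ m, |ε m| = 1)
    (hσ : ∀ m g, IsSign (F g) → coord g m = ε m * coord (F g) (σ m))
    (hn : ∀ f : unitBallEllInfty, ‖(f : EllInfty)‖ = 1 → 1 / 2 < ‖(F f : EllInfty)‖) :
    Function.Injective σ := by
  have hbig : ∀ m (c : ℝ), |c| = 1 → ∃ x : unitBallEllInfty,
      (∀ j, coord x j = if j = m then c else 0) ∧ 1 / 2 < c * ε m * coord (F x) (σ m) := by
    intro m c hc
    obtain ⟨x, hx⟩ := exists_coord (fun j => if j = m then c else 0) (by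
      intro j; split_ifs <;> simp [hc])
    have hxn : ‖(x : EllInfty)‖ = 1 := by
      refine le_antisymm (mem_closedBall_zero_iff.mp x.2) ?_
      have := (norm_le_iff (norm_nonneg _)).mp (le_refl ‖(x : EllInfty)‖) m
      rwa [hx, if_pos rfl, hc] at this
    have hk : ∃ k, 1 / 2 < |coord (F x) k| := by
      by_contra! hcon
      exact (hn x hxn).not_ge ((norm_le_iff (by norm_num)).mpr hcon)
    obtain ⟨k, hk⟩ := hk
    obtain ⟨rfl, hp⟩ := eq_and_pos_of_coord_map_ne_zero hL hb hε hσ (x := x) (m := m) (k := k)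
      (fun j hj => by rw [hx, if_neg hj]) (abs_pos.mp (by linarith))
    refine ⟨x, hx, ?_⟩
    rw [hx, if_pos rfl] at hp
    have hcc : unitSign c = c := by
      rcases eq_or_eq_neg_of_abs_eq hc with h | h <;> rw [h, unitSign] <;> norm_num
    rw [hcc] at hp
    have habs : |c * ε m * coord (F x) (σ m)| = |coord (F x) (σ m)| := by
      rw [abs_mul, abs_mul, hc, hε, one_mul, one_mul]
    rw [abs_of_pos hp] at habs
    rwa [habs]
  intro m m' hmm'
  by_contra hne
  obtain ⟨x, hx, hx2⟩ := hbig m (ε m) (hε m)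
  obtain ⟨y, hy, hy2⟩ := hbig m' (-ε m') (by rw [abs_neg, hε])
  have hεε : ∀ m, ε m * ε m = 1 := fun m => by rw [← abs_mul_abs_self, hε, one_mul]
  rw [hεε, one_mul] at hx2
  rw [neg_mul, hεε, neg_one_mul, ← hmm'] at hy2
  have key := abs_coord_map_sub_le hL (x := x) (y := y) (r := 1) (by
    intro j
    rw [hx, hy]
    split_ifs with h1 h2
    · exact absurd (h1.symm.trans h2) hne
    · rw [sub_zero, hε]
    · rw [zero_sub, neg_neg, hε]
    · simp) (σ m)
  linarith [(abs_le.mp key).2]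

end Preimage

/-! ### Reduction to the case of fixed sign vectors -/

theorem isometry_of_injective {F : unitBallEllInfty → unitBallEllInfty}
    (hL : LipschitzWith 1 F) (hb : Function.Bijective F)
    {σ : ℕ → ℕ} {ε : ℕ → ℝ} (hε : ∀ m, |ε m| = 1)
    (hσ : ∀ m g, IsSign (F g) → coord g m = ε m * coord (F g) (σ m))
    (hinj : Function.Injective σ) : Isometry F := by
  have hsurj := surjective_of_coord_preimage_eq hb.2 hσ
  have hεε : ∀ m, ε m * ε m = 1 := fun m => by rw [← abs_mul_abs_self, hε, one_mul]
  -- The signed permutation `U` of coordinates inverts `F` on the sign vectors.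
  choose U hU using fun f : unitBallEllInfty =>
    exists_coord (fun m => ε m * coord f (σ m)) (by
      intro m; rw [abs_mul, hε, one_mul]; exact abs_coord_le_one _ _)
  have hUiso : Isometry U := by
    refine Isometry.of_dist_eq fun f g => ?_
    have hd : ∀ m, |coord (U f) m - coord (U g) m| = |coord f (σ m) - coord g (σ m)| := fun m => by
      rw [hU, hU, ← mul_sub, abs_mul, hε, one_mul]
    refine le_antisymm ((dist_le_iff dist_nonneg).mpr fun m => ?_)
      ((dist_le_iff dist_nonneg).mpr fun k => ?_)
    · rw [hd]; exact (dist_le_iff dist_nonneg).mp le_rfl _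
    · obtain ⟨m, rfl⟩ := hsurj k
      rw [← hd]; exact (dist_le_iff dist_nonneg).mp le_rfl _
  have hUsurj : Function.Surjective U := by
    intro f
    let σ' := Equiv.ofBijective σ ⟨hinj, hsurj⟩
    have hσ' : ∀ m, σ'.symm (σ m) = m := σ'.symm_apply_apply
    obtain ⟨g, hg⟩ := exists_coord (fun k => ε (σ'.symm k) * coord f (σ'.symm k)) (by
      intro m; rw [abs_mul, hε, one_mul]; exact abs_coord_le_one _ _)
    exact ⟨g, ext_coord fun m => by rw [hU, hg, hσ', ← mul_assoc, hεε, one_mul]⟩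
  have hfix : ∀ f, F (U f) = f := by
    refine eq_self_of_fixes_sign (H := F ∘ U) ?_ (hb.comp ⟨hUiso.injective, hUsurj⟩) ?_
    · simpa using hL.comp hUiso.lipschitz
    · intro e he
      obtain ⟨g, rfl⟩ := hb.2 e
      exact congrArg F (ext_coord fun m => by rw [hU, hσ m g he])
  refine Isometry.of_dist_eq fun f g => ?_
  obtain ⟨f, rfl⟩ := hUsurj f
  obtain ⟨g, rfl⟩ := hUsurj g
  rw [hfix, hfix, hUiso.dist_eq]

end UnitBallEllInfty

/-! ### The isometry theorem -/

open UnitBallEllInfty in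
theorem corollary5p3
    (F : unitBallEllInfty → unitBallEllInfty)
    (hbij : Function.Bijective F)
    (hnonexp : LipschitzWith 1 F)
    (h : (∀ f : unitBallEllInfty,
            (f : EllInfty) ∈ Set.extremePoints ℝ unitBallEllInfty →
              (F f : EllInfty) ∈ Set.extremePoints ℝ unitBallEllInfty) ∨
          sInf ((fun f : unitBallEllInfty => ‖(F f : EllInfty)‖) ''
            {f : unitBallEllInfty | ‖(f : EllInfty)‖ = 1}) > 1 / 2) :
    Isometry F := by
  choose σ ε hε hσ using exists_coord_preimage_eq hnonexp hbij
  refine isometry_of_injective hnonexp hbij hε hσ ?_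
  rcases h with ha | hb
  · exact injective_of_isSign_map hε hσ fun f hf =>
      (mem_extremePoints_iff_isSign _).mp (ha f ((mem_extremePoints_iff_isSign f).mpr hf))
  · refine injective_of_half_lt_norm hnonexp hbij hε hσ fun f hf => hb.trans_le ?_
    exact csInf_le ⟨0, by rintro _ ⟨g, -, rfl⟩; exact norm_nonneg _⟩ ⟨f, hf, rfl⟩
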